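/- Let $k\ge 2$. For $\theta=(\pi,\mu,\sigma)\in\Delta_{k-1}\times\mathbb{R}^k\times(0,\infty)^k$, where $\Delta_{k-1}$ is the probability simplex, let $$f_\theta(x)=\sum_{j=1}^k \pi_j\,\frac{1}{\sigma_j\sqrt{2\pi}}\exp\!\Big(-\frac{(x-\mu_j)^2}{2\sigma_j^2}\Big)$$ (under the root, $\pi$ is the number). For $m\ge 1$ and $\varepsilon\in(0,1/k]$ let $$S_{m,\varepsilon}=\{\pi\in\Delta_{k-1}:\min_j\pi_j\ge\varepsilon\}\times[-m,m]^k\times[e^{-m},e^m]^k .$$ Let $\theta_0=(\pi^0,\mu^0,\sigma^0)$ have strictly positive weights and pairwise distinct pairs $(\mu^0_j,\sigma^0_j)$, and assume $\theta_0\in S_{m,\varepsilon}$. Let $\Theta_0$ be the orbit of $\theta_0$ under simultaneous permutation of the components. Let $X_1,X_2,\dots$ be i.i.d. real random variables with density $f_{\theta_0}$, and let $\ell_n(\theta)=\sum_{i=1}^n\log f_\theta(X_i)$. For two parameters put $$d_{\min}(\theta,\theta')=\min_{\tau\in\mathfrak{S}_k}\big(\|\tau(\mu)-\mu'\|_2+\|\tau(\sigma)-\sigma'\|_2+\|\tau(\pi)-\pi'\|_1\big),$$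 and for a distance $d$ and sets $A,B$ let $d_H(A,B)=\max\{\sup_{a\in A}\inf_{b\in B}d(a,b),\ \sup_{b\in B}\inf_{a\in A}d(a,b)\}$. Then: 1. The set $\arg\max_{S_{m,\varepsilon}}\ell_n$ of sieve maximum likelihood estimators is nonempty for every $n$ and every realization of the sample. 2. Almost surely, for every choice of nonempty sets $\widehat\Theta_n\subseteq\arg\max_{S_{m,\varepsilon}}\ell_n$ (in particular for the full sets of maximizers), $d_H(\widehat\Theta_n,\Theta_0)\to 0$ as $n\to\infty$, where $d_H$ is induced by $d_{\min}$. If moreover every $\widehat\Theta_n$ is invariant under permutations of the components (as the full sets of maximizers are), then also $d_H(\widehat\Theta_n,\Theta_0)\to0$ for the $d_H$ induced by the Euclidean distance of $\mathbb{R}^{3k}$. -/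

import Mathlib

open MeasureTheory ProbabilityTheory Filter
open scoped ENNReal Topology

namespace GaussianMixture

/-- A triple `(π, μ, σ)` of weights, means and standard deviations, before any constraint is
imposed (see `parameterSpace`). -/
abbrev Param (k : ℕ) : Type := (Fin k → ℝ) × (Fin k → ℝ) × (Fin k → ℝ)

namespace Param

variable {k : ℕ}

/-- The weights `π` of `θ = (π, μ, σ)`. -/
abbrev weight (θ : Param k) : Fin k → ℝ := θ.1

/-- The means `μ` of `θ = (π, μ, σ)`. -/
abbrev mean (θ : Param k) : Fin k → ℝ := θ.2.1

/-- The standard deviations `σ` of `θ = (π, μ, σ)`. -/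
abbrev sd (θ : Param k) : Fin k → ℝ := θ.2.2

/-- Relabelling of the components by a permutation. -/
def permute (τ : Equiv.Perm (Fin k)) (θ : Param k) : Param k :=
  (θ.weight ∘ τ, θ.mean ∘ τ, θ.sd ∘ τ)

end Param

/-- The parameter space: the product of the probability simplex, `ℝ^k` and `(0, ∞)^k`. -/
def parameterSpace (k : ℕ) : Set (Param k) :=
  {θ | θ.weight ∈ stdSimplex ℝ (Fin k) ∧ ∀ j, 0 < θ.sd j}

/-- The sieve `S_{m,ε}`: all weights at least `ε`, means in `[-m, m]`, standard deviations in
`[exp (-m), exp m]`. -/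
def sieve (k : ℕ) (m ε : ℝ) : Set (Param k) :=
  {θ | θ.weight ∈ stdSimplex ℝ (Fin k) ∧ (∀ j, ε ≤ θ.weight j) ∧
    (∀ j, θ.mean j ∈ Set.Icc (-m) m) ∧
    (∀ j, θ.sd j ∈ Set.Icc (Real.exp (-m)) (Real.exp m))}

/-- The mixture density `f_θ(x) = ∑ j, π_j φ(x; μ_j, σ_j)`, where `φ(·; μ, σ)` is the Gaussian
density with mean `μ` and variance `σ ^ 2`. -/
noncomputable def density {k : ℕ} (θ : Param k) (x : ℝ) : ℝ :=
  ∑ j, θ.weight j * gaussianPDFReal (θ.mean j) ((θ.sd j ^ 2).toNNReal) x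

/-- The law on `ℝ` with Lebesgue density `f_θ`. -/
noncomputable def law {k : ℕ} (θ : Param k) : Measure ℝ :=
  volume.withDensity fun x => ENNReal.ofReal (density θ x)

/-- The log-likelihood of `θ` for the first `n` terms of the data sequence `x`. -/
noncomputable def logLikelihood {k : ℕ} (x : ℕ → ℝ) (n : ℕ) (θ : Param k) : ℝ :=
  ∑ i ∈ Finset.range n, Real.log (density θ (x i))

/-- The set of all maximizers over `S_{m,ε}` of the log-likelihood of the first `n` data. -/
def sieveMLE (k : ℕ) (m ε : ℝ) (x : ℕ → ℝ) (n : ℕ) : Set (Param k) :=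
  {θ | θ ∈ sieve k m ε ∧ IsMaxOn (logLikelihood x n) (sieve k m ε) θ}

/-- The permutation orbit of `θ`. -/
def permOrbit {k : ℕ} (θ : Param k) : Set (Param k) :=
  Set.range fun τ : Equiv.Perm (Fin k) => θ.permute τ

/-- The minimum matching distance: the minimum over all permutations `τ` of
`‖τ(μ) - μ'‖₂ + ‖τ(σ) - σ'‖₂ + ‖τ(π) - π'‖₁`. -/
noncomputable def matchingDist {k : ℕ} (θ θ' : Param k) : ℝ :=
  ⨅ τ : Equiv.Perm (Fin k),
    (√(∑ j, (θ.mean (τ j) - θ'.mean j) ^ 2) + √(∑ j, (θ.sd (τ j) - θ'.sd j) ^ 2)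
      + ∑ j, |θ.weight (τ j) - θ'.weight j|)

/-- The Euclidean distance of `(π, μ, σ)` and `(π', μ', σ')` as vectors of `ℝ^{3k}`. -/
noncomputable def euclideanDist {k : ℕ} (θ θ' : Param k) : ℝ :=
  √(∑ j, ((θ.weight j - θ'.weight j) ^ 2 + (θ.mean j - θ'.mean j) ^ 2
      + (θ.sd j - θ'.sd j) ^ 2))

/-- The Hausdorff distance of two sets induced by a distance function `d ≥ 0`, with values in
`[0, ∞]`, so that suprema and infima are genuine. -/
noncomputable def hausdorffDistOf {α : Type*} (d : α → α → ℝ) (A B : Set α) : ℝ≥0∞ :=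
  max (⨆ a ∈ A, ⨅ b ∈ B, ENNReal.ofReal (d a b)) (⨆ b ∈ B, ⨅ a ∈ A, ENNReal.ofReal (d a b))

/-- For the distance of a metric space this is the usual Hausdorff distance. -/
theorem hausdorffDistOf_dist {α : Type*} [PseudoMetricSpace α] (A B : Set α) :
    hausdorffDistOf (dist : α → α → ℝ) A B = Metric.hausdorffEDist A B := by
  rw [Metric.hausdorffEDist_def]
  simp only [hausdorffDistOf, Metric.infEDist, edist_dist, dist_comm]

end GaussianMixture

namespace GaussianMixture

/-! This is Wald's consistency argument on a compact parameter set. On the sieve `|log f_θ(x)| ≤ C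
(1 + x²)` uniformly in `θ` (`exists_abs_log_density_le`), and the right side is integrable under
`law θ₀`. So `x ↦ log f_•(x)` is a Bochner integrable element of the Banach space of continuous
functions on the sieve, and the strong law there makes `ℓ_n / n` converge uniformly to `L(θ) = E log
f_θ(X)`.

By Gibbs' inequality, `L θ₀ ≤ L θ` forces `f_θ = f_θ₀`. Gaussians with distinct parameters are
linearly independent, so `θ` then lies in the orbit of `θ₀` (`mem_permOrbit_of_density_eq`). By
compactness `L` stays below `L θ₀` by a fixed margin off any open neighbourhood of the orbit, so all
maximizers eventually enter it. Relabelling turns this into Hausdorff convergence. -/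

lemma gaussianPDFReal_toNNReal_sq (μ x : ℝ) {σ : ℝ} (hσ : 0 < σ) :
    gaussianPDFReal μ (σ ^ 2).toNNReal x =
      (√(2 * Real.pi) * σ)⁻¹ * Real.exp (-(x - μ) ^ 2 / (2 * σ ^ 2)) := by
  rw [gaussianPDFReal, Real.coe_toNNReal _ (sq_nonneg σ), Real.sqrt_mul (by positivity),
    Real.sqrt_sq hσ.le]

lemma toNNReal_sq_ne_zero {σ : ℝ} (hσ : 0 < σ) : (σ ^ 2).toNNReal ≠ 0 := by
  rw [Ne, Real.toNNReal_eq_zero, not_le]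
  positivity

/-! ### Identifiability of Gaussian mixtures -/

section Identifiability

/-- The Gaussian density with the lexicographically ordered parameter `(σ, μ)`. -/
noncomputable def lexGaussian (p : ℝ ×ₗ ℝ) (x : ℝ) : ℝ :=
  gaussianPDFReal (ofLex p).2 ((ofLex p).1 ^ 2).toNNReal x

/-- Meant for the exponent of a ratio of two Gaussians. The linear coefficient decides only when the
quadratic one vanishes, which is why parameters are ordered lexicographically with `σ` first. -/
lemma tendsto_quadratic_atTop {a b c : ℝ} (h : a < 0 ∨ a = 0 ∧ b < 0) :
    Tendsto (fun x : ℝ => a * x ^ 2 + b * x + c) atTop atBot := by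
  have hid : Tendsto (fun x : ℝ => x) atTop atTop := tendsto_id
  rcases h with ha | ⟨rfl, hb⟩
  · have h1 : Tendsto (fun x : ℝ => x * (a * x + b)) atTop atBot :=
      hid.atTop_mul_atBot₀ (tendsto_atBot_add_const_right _ b (hid.const_mul_atTop_of_neg ha))
    refine (tendsto_atBot_add_const_right _ c h1).congr fun x => ?_
    ring
  · refine (tendsto_atBot_add_const_right _ c (hid.const_mul_atTop_of_neg hb)).congr fun x => ?_
    ring

/-- Among two Gaussian densities the one with the larger `(σ, μ)` has the heavier right tail. -/
lemma tendsto_lexGaussian_div {p q : ℝ ×ₗ ℝ} (hp : 0 < (ofLex p).1) (hpq : p < q) :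
    Tendsto (fun x => lexGaussian p x / lexGaussian q x) atTop (𝓝 0) := by
  have hlt := Prod.Lex.lt_iff.1 hpq
  have hq : 0 < (ofLex q).1 := by
    rcases hlt with h | ⟨h, -⟩
    · exact hp.trans h
    · exact h ▸ hp
  simp only [lexGaussian]
  generalize (ofLex p).1 = σ at *
  generalize (ofLex p).2 = μ at *
  generalize (ofLex q).1 = σ' at *
  generalize (ofLex q).2 = μ' at *
  have hquad : Tendsto (fun x : ℝ => (1 / (2 * σ' ^ 2) - 1 / (2 * σ ^ 2)) * x ^ 2 +
      (μ / σ ^ 2 - μ' / σ' ^ 2) * x + (μ' ^ 2 / (2 * σ' ^ 2) - μ ^ 2 / (2 * σ ^ 2)))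
      atTop atBot := by
    refine tendsto_quadratic_atTop ?_
    rcases hlt with h | ⟨h, h'⟩
    · left
      rw [sub_neg]
      gcongr
    · right
      subst h
      refine ⟨sub_self _, ?_⟩
      rw [sub_neg]
      gcongr
  have := (Real.tendsto_exp_atBot.comp hquad).const_mul (σ' / σ)
  rw [mul_zero] at this
  refine this.congr fun x => ?_
  rw [gaussianPDFReal_toNNReal_sq _ _ hp, gaussianPDFReal_toNNReal_sq _ _ hq, mul_div_mul_comm,
    ← Real.exp_sub, Function.comp_apply]
  congr 1
  · have : √(2 * Real.pi) ≠ 0 := by positivity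
    field_simp
  · congr 1
    field_simp
    ring

/-- Gaussian densities with pairwise distinct parameters are linearly independent. -/
lemma lexGaussian_linearIndependent (s : Finset (ℝ ×ₗ ℝ)) :
    (∀ p ∈ s, 0 < (ofLex p).1) → ∀ c : ℝ ×ₗ ℝ → ℝ,
      (∀ x, ∑ p ∈ s, c p * lexGaussian p x = 0) → ∀ p ∈ s, c p = 0 := by
  induction s using Finset.induction_on_max with
  | empty => simp
  | insert a s hmax ih =>
    intro hs c hc
    have ha : a ∉ s := fun h => lt_irrefl _ (hmax a h)
    have hpos : ∀ x, lexGaussian a x ≠ 0 := fun x =>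
      (gaussianPDFReal_pos _ _ _ (toNNReal_sq_ne_zero (hs a (Finset.mem_insert_self a s)))).ne'
    -- Divide the relation by the heaviest-tailed Gaussian `a`: the other terms vanish at infinity,
    -- yet their sum is constantly `-c a`.
    have hlim : Tendsto (fun x => ∑ p ∈ s, c p * (lexGaussian p x / lexGaussian a x)) atTop
        (𝓝 (∑ p ∈ s, c p * 0)) :=
      tendsto_finsetSum _ fun p hp => (tendsto_lexGaussian_div
        (hs p (Finset.mem_insert_of_mem hp)) (hmax p hp)).const_mul (c p)
    have hconst : ∀ x, ∑ p ∈ s, c p * (lexGaussian p x / lexGaussian a x) = -c a := by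
      intro x
      have h := hc x
      rw [Finset.sum_insert ha] at h
      simp_rw [← mul_div_assoc]
      rw [← Finset.sum_div, div_eq_iff (hpos x)]
      linarith
    simp_rw [hconst] at hlim
    have hca : c a = 0 := by
      have := tendsto_nhds_unique tendsto_const_nhds hlim
      simpa using this
    intro p hp
    rcases Finset.mem_insert.1 hp with rfl | hp
    · exact hca
    · refine ih (fun p hp => hs p (Finset.mem_insert_of_mem hp)) c (fun x => ?_) p hp
      simpa [Finset.sum_insert ha, hca] using hc x

/-- The mixing measure of a mixture with positive weights and distinct components is determined by
its density, among all mixtures with the same number of components. -/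
theorem mem_permOrbit_of_density_eq {k : ℕ} {θ θ₀ : Param k} (hsd : ∀ j, 0 < θ.sd j)
    (hsd₀ : ∀ j, 0 < θ₀.sd j) (hpos : ∀ j, 0 < θ₀.weight j)
    (hdistinct : Function.Injective fun j => (θ₀.mean j, θ₀.sd j))
    (h : ∀ x, density θ x = density θ₀ x) : θ ∈ permOrbit θ₀ := by
  classical
  let pt : Param k → Fin k → ℝ ×ₗ ℝ := fun η j => toLex (η.sd j, η.mean j)
  let s : Finset (ℝ ×ₗ ℝ) := Finset.univ.image (pt θ) ∪ Finset.univ.image (pt θ₀)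
  -- The mass of the mixing measure at `p`. Components of `θ` may coincide a priori, hence the sum
  -- over a fibre.
  let w : Param k → ℝ ×ₗ ℝ → ℝ := fun η p => ∑ j with pt η j = p, η.weight j
  have hinj : Function.Injective (pt θ₀) := by
    intro i j hij
    have := congrArg ofLex hij
    simp only [pt, ofLex_toLex, Prod.mk.injEq] at this
    exact hdistinct (Prod.ext this.2 this.1)
  have hdens : ∀ η : Param k, (∀ j, pt η j ∈ s) → ∀ x,
      ∑ p ∈ s, w η p * lexGaussian p x = density η x := by
    intro η hη x
    simp only [w, density, Finset.sum_mul]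
    rw [← Finset.sum_fiberwise_of_maps_to (t := s) (g := pt η) (fun j _ => hη j)]
    refine Finset.sum_congr rfl fun p _ => Finset.sum_congr rfl fun j hj => ?_
    rw [← (Finset.mem_filter.1 hj).2]
    rfl
  have hmem : ∀ j, pt θ j ∈ s := fun j =>
    Finset.mem_union_left _ (Finset.mem_image_of_mem _ (Finset.mem_univ j))
  have hmem₀ : ∀ j, pt θ₀ j ∈ s := fun j =>
    Finset.mem_union_right _ (Finset.mem_image_of_mem _ (Finset.mem_univ j))
  have hw : ∀ p ∈ s, w θ p - w θ₀ p = 0 := by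
    refine lexGaussian_linearIndependent s (fun p hp => ?_) (fun p => w θ p - w θ₀ p) fun x => ?_
    · rcases Finset.mem_union.1 hp with hp | hp <;> obtain ⟨j, -, rfl⟩ := Finset.mem_image.1 hp
      · exact hsd j
      · exact hsd₀ j
    · simp_rw [sub_mul]
      rw [Finset.sum_sub_distrib, hdens θ hmem, hdens θ₀ hmem₀, h, sub_self]
  have hw₀ : ∀ j, w θ (pt θ₀ j) = θ₀.weight j := by
    intro j
    rw [sub_eq_zero.1 (hw _ (hmem₀ j))]
    have : Finset.univ.filter (fun i => pt θ₀ i = pt θ₀ j) = {j} := by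
      ext i
      simp [hinj.eq_iff]
    simp only [w, this, Finset.sum_singleton]
  have hex : ∀ j, ∃ i, pt θ i = pt θ₀ j := by
    intro j
    have hne : w θ (pt θ₀ j) ≠ 0 := by
      rw [hw₀]
      exact (hpos j).ne'
    obtain ⟨i, hi, -⟩ := Finset.exists_ne_zero_of_sum_ne_zero hne
    exact ⟨i, (Finset.mem_filter.1 hi).2⟩
  -- Every atom of `θ₀` is also one of `θ`. As both have `k` components, the injection `t` is a
  -- bijection and `θ` has no further atoms.
  choose t ht using hex
  have htinj : Function.Injective t := fun i j hij => hinj (by rw [← ht i, ← ht j, hij])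
  let τ : Equiv.Perm (Fin k) := Equiv.ofBijective t (Finite.injective_iff_bijective.1 htinj)
  have hτ : ∀ j, pt θ (τ j) = pt θ₀ j := ht
  have hweight : ∀ j, θ.weight (τ j) = θ₀.weight j := by
    intro j
    rw [← hw₀ j]
    have : Finset.univ.filter (fun i => pt θ i = pt θ₀ j) = {τ j} := by
      ext i
      obtain ⟨l, rfl⟩ := τ.surjective i
      simp [hτ, hinj.eq_iff]
    simp only [w, this, Finset.sum_singleton]
  have hpair : ∀ j, θ.sd (τ j) = θ₀.sd j ∧ θ.mean (τ j) = θ₀.mean j := fun j => by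
    have := congrArg ofLex (hτ j)
    simpa only [pt, ofLex_toLex, Prod.mk.injEq] using this
  refine ⟨τ⁻¹, ?_⟩
  refine Prod.ext (funext fun j => ?_) (Prod.ext (funext fun j => ?_) (funext fun j => ?_))
  · simpa [Param.permute] using (hweight (τ⁻¹ j)).symm
  · simpa [Param.permute] using (hpair (τ⁻¹ j)).2.symm
  · simpa [Param.permute] using (hpair (τ⁻¹ j)).1.symm

end Identifiability

end GaussianMixture

/-! ### Compactness of the sieve and bounds on the density -/

namespace GaussianMixture

variable {k : ℕ} {m ε : ℝ}

lemma sd_pos_of_mem_sieve {θ : Param k} (hθ : θ ∈ sieve k m ε) (j : Fin k) : 0 < θ.sd j :=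
  (Real.exp_pos _).trans_le (hθ.2.2.2 j).1

lemma isCompact_sieve : IsCompact (sieve k m ε) := by
  have hK : IsCompact (stdSimplex ℝ (Fin k) ×ˢ ((Set.univ.pi fun _ : Fin k => Set.Icc (-m) m) ×ˢ
      (Set.univ.pi fun _ : Fin k => Set.Icc (Real.exp (-m)) (Real.exp m)))) :=
    (isCompact_stdSimplex ℝ (Fin k)).prod ((isCompact_univ_pi fun _ => isCompact_Icc).prod
      (isCompact_univ_pi fun _ => isCompact_Icc))
  have hC : IsClosed {θ : Param k | ∀ j, ε ≤ θ.weight j} := by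
    simp only [Set.ofPred_forall]
    exact isClosed_iInter fun j => isClosed_le continuous_const (by fun_prop)
  convert hK.inter_right hC using 1
  ext θ
  simp only [sieve, Set.mem_ofPred_eq, Set.mem_inter_iff, Set.mem_prod, Set.mem_univ_pi]
  tauto

lemma continuousOn_density :
    ContinuousOn (fun p : Param k × ℝ => density p.1 p.2) {p | ∀ j, 0 < p.1.sd j} := by
  have : ContinuousOn (fun p : Param k × ℝ => ∑ j, p.1.weight j *
      ((√(2 * Real.pi) * p.1.sd j)⁻¹ *
        Real.exp (-(p.2 - p.1.mean j) ^ 2 / (2 * p.1.sd j ^ 2)))) {p | ∀ j, 0 < p.1.sd j} := by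
    refine continuousOn_finsetSum _ fun j _ => ?_
    have hw : ContinuousOn (fun p : Param k × ℝ => p.1.weight j) {p | ∀ j, 0 < p.1.sd j} :=
      Continuous.continuousOn (by fun_prop)
    have hs : ContinuousOn (fun p : Param k × ℝ => √(2 * Real.pi) * p.1.sd j)
        {p | ∀ j, 0 < p.1.sd j} := Continuous.continuousOn (by fun_prop)
    have hn : ContinuousOn (fun p : Param k × ℝ => -(p.2 - p.1.mean j) ^ 2)
        {p | ∀ j, 0 < p.1.sd j} := Continuous.continuousOn (by fun_prop)
    have hd : ContinuousOn (fun p : Param k × ℝ => 2 * p.1.sd j ^ 2)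
        {p | ∀ j, 0 < p.1.sd j} := Continuous.continuousOn (by fun_prop)
    refine hw.mul ((hs.inv₀ fun p hp => ?_).mul (hn.div hd fun p hp => ?_).rexp)
    · have := hp j
      positivity
    · have := hp j
      positivity
  refine this.congr fun p hp => ?_
  exact Finset.sum_congr rfl fun j _ => by rw [gaussianPDFReal_toNNReal_sq _ _ (hp j)]

lemma continuous_density {θ : Param k} (hθ : ∀ j, 0 < θ.sd j) : Continuous (density θ) :=
  continuousOn_density.comp_continuous (f := fun x : ℝ => (θ, x)) (by fun_prop) fun _ => hθ

lemma density_le {θ : Param k} (hθ : θ ∈ sieve k m ε) (x : ℝ) :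
    density θ x ≤ Real.exp m := by
  have hφ : ∀ j, gaussianPDFReal (θ.mean j) ((θ.sd j ^ 2).toNNReal) x ≤ Real.exp m := by
    intro j
    have hσ := sd_pos_of_mem_sieve hθ j
    rw [gaussianPDFReal_toNNReal_sq _ _ hσ]
    have h1 : (1 : ℝ) ≤ √(2 * Real.pi) := by
      rw [Real.one_le_sqrt]
      linarith [Real.pi_gt_three]
    have h2 : (√(2 * Real.pi) * θ.sd j)⁻¹ ≤ Real.exp m := by
      rw [← inv_inv (Real.exp m), ← Real.exp_neg]
      gcongr
      nlinarith [(hθ.2.2.2 j).1]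
    have h3 : Real.exp (-(x - θ.mean j) ^ 2 / (2 * θ.sd j ^ 2)) ≤ 1 := by
      rw [Real.exp_le_one_iff, neg_div]
      exact neg_nonpos.2 (by positivity)
    calc _ ≤ Real.exp m * 1 := by gcongr
      _ = _ := mul_one _
  calc density θ x ≤ ∑ j, θ.weight j * Real.exp m :=
        Finset.sum_le_sum fun j _ => mul_le_mul_of_nonneg_left (hφ j) (hθ.1.1 j)
    _ = Real.exp m := by rw [← Finset.sum_mul, hθ.1.2, one_mul]

/-- Each component obeys the bound, by `σ ≤ e^m` in the prefactor and `(x - μ)² ≤ 2 (x² + m²)`, `σ⁻²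
≤ e^(2m)` in the exponent; averaging with the weights preserves it. -/
lemma le_density {θ : Param k} (hθ : θ ∈ sieve k m ε) (x : ℝ) :
    (√(2 * Real.pi) * Real.exp m)⁻¹ * Real.exp (-(x ^ 2 + m ^ 2) * Real.exp (2 * m)) ≤
      density θ x := by
  have hφ : ∀ j, (√(2 * Real.pi) * Real.exp m)⁻¹ *
      Real.exp (-(x ^ 2 + m ^ 2) * Real.exp (2 * m)) ≤
        gaussianPDFReal (θ.mean j) ((θ.sd j ^ 2).toNNReal) x := by
    intro j
    have hσ := sd_pos_of_mem_sieve hθ j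
    rw [gaussianPDFReal_toNNReal_sq _ _ hσ]
    have h1 : (√(2 * Real.pi) * Real.exp m)⁻¹ ≤ (√(2 * Real.pi) * θ.sd j)⁻¹ := by
      gcongr
      exact (hθ.2.2.2 j).2
    have h2 : (x - θ.mean j) ^ 2 ≤ 2 * (x ^ 2 + m ^ 2) := by
      have := sq_le_sq' (hθ.2.2.1 j).1 (hθ.2.2.1 j).2
      nlinarith [sq_nonneg (x + θ.mean j)]
    have h3 : (1 : ℝ) ≤ θ.sd j ^ 2 * Real.exp (2 * m) := by
      calc (1 : ℝ) = Real.exp (-m) ^ 2 * Real.exp (2 * m) := by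
            rw [← Real.exp_nat_mul, ← Real.exp_add]
            simp
        _ ≤ _ := by
          gcongr
          exact (hθ.2.2.2 j).1
    have h4 : -(x ^ 2 + m ^ 2) * Real.exp (2 * m) ≤ -(x - θ.mean j) ^ 2 / (2 * θ.sd j ^ 2) := by
      rw [le_div_iff₀ (by positivity)]
      nlinarith [mul_le_mul_of_nonneg_left h3 (by positivity : 0 ≤ 2 * (x ^ 2 + m ^ 2))]
    exact mul_le_mul h1 (Real.exp_le_exp.2 h4) (by positivity) (by positivity)
  calc _ = ∑ j, θ.weight j * ((√(2 * Real.pi) * Real.exp m)⁻¹ *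
        Real.exp (-(x ^ 2 + m ^ 2) * Real.exp (2 * m))) := by
        rw [← Finset.sum_mul, hθ.1.2, one_mul]
    _ ≤ density θ x :=
        Finset.sum_le_sum fun j _ => mul_le_mul_of_nonneg_left (hφ j) (hθ.1.1 j)

lemma density_pos {θ : Param k} (hθ : θ ∈ sieve k m ε) (x : ℝ) : 0 < density θ x :=
  lt_of_lt_of_le (by positivity) (le_density hθ x)

/-- On the sieve the log-density is bounded by a quadratic polynomial. -/
lemma exists_abs_log_density_le (k : ℕ) (m ε : ℝ) :
    ∃ C : ℝ, 0 ≤ C ∧ ∀ θ ∈ sieve k m ε, ∀ x, |Real.log (density θ x)| ≤ C * (1 + x ^ 2) := by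
  let c := Real.log (√(2 * Real.pi) * Real.exp m)
  have he := Real.exp_pos (2 * m)
  refine ⟨|m| + |c| + (1 + m ^ 2) * Real.exp (2 * m), by positivity, fun θ hθ x => ?_⟩
  have hup : Real.log (density θ x) ≤ m := by
    rw [Real.log_le_iff_le_exp (density_pos hθ x)]
    exact density_le hθ x
  have hlow : -c - (x ^ 2 + m ^ 2) * Real.exp (2 * m) ≤ Real.log (density θ x) := by
    have := Real.log_le_log (by positivity) (le_density hθ x)
    rw [Real.log_mul (by positivity) (by positivity), Real.log_inv, Real.log_exp] at this
    simp only [c]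
    linarith
  have h1 := le_abs_self m
  have h2 := le_abs_self c
  have h3 := abs_nonneg m
  have h4 := abs_nonneg c
  have h5 : 0 ≤ (|m| + |c|) * x ^ 2 := by positivity
  have h6 : 0 ≤ m ^ 2 * x ^ 2 * Real.exp (2 * m) := by positivity
  have h7 : 0 ≤ x ^ 2 * Real.exp (2 * m) := by positivity
  have h8 : 0 ≤ m ^ 2 * Real.exp (2 * m) := by positivity
  rw [abs_le]
  constructor <;> nlinarith

lemma continuousOn_log_density :
    ContinuousOn (fun p : Param k × ℝ => Real.log (density p.1 p.2))
      (sieve k m ε ×ˢ Set.univ) :=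
  (continuousOn_density.mono fun _ hp => sd_pos_of_mem_sieve hp.1).log
    fun p hp => (density_pos hp.1 p.2).ne'

lemma continuousOn_logLikelihood (x : ℕ → ℝ) (n : ℕ) :
    ContinuousOn (logLikelihood x n) (sieve k m ε) :=
  continuousOn_finsetSum _ fun i _ =>
    continuousOn_log_density.comp (f := fun θ : Param k => (θ, x i))
      (Continuous.continuousOn (by fun_prop)) fun _ hθ => ⟨hθ, Set.mem_univ _⟩

/-- Sieve maximum likelihood estimators exist. -/
theorem sieveMLE_nonempty (h : (sieve k m ε).Nonempty) (x : ℕ → ℝ) (n : ℕ) :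
    (sieveMLE k m ε x n).Nonempty :=
  isCompact_sieve.exists_isMaxOn h (continuousOn_logLikelihood x n)

/-! ### Moments and Gibbs' inequality -/

lemma integrable_density_mul_pow {θ : Param k} (hθ : ∀ j, 0 < θ.sd j) (p : ℕ) :
    Integrable fun x => density θ x * x ^ p := by
  simp only [density, Finset.sum_mul, mul_assoc]
  refine integrable_finsetSum _ fun j _ => Integrable.const_mul ?_ _
  have hv := toNNReal_sq_ne_zero (hθ j)
  have h : Integrable (fun x : ℝ => x ^ p)
      (gaussianReal (θ.mean j) ((θ.sd j ^ 2).toNNReal)) := by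
    refine (integrable_norm_iff (by fun_prop)).1 ?_
    have := (memLp_id_gaussianReal (μ := θ.mean j) (v := (θ.sd j ^ 2).toNNReal) p).integrable_norm_pow'
    simpa using this
  rw [gaussianReal_of_var_ne_zero _ hv, integrable_withDensity_iff_integrable_smul'
    (measurable_gaussianPDF _ _) (ae_of_all _ fun x => gaussianPDF_lt_top)] at h
  simpa [toReal_gaussianPDF] using h

lemma integral_density {θ : Param k} (hθ : θ ∈ sieve k m ε) : ∫ x, density θ x = 1 := by
  simp only [density]
  rw [integral_finsetSum _ fun j _ => (integrable_gaussianPDFReal _ _).const_mul _]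
  simp_rw [integral_const_mul,
    integral_gaussianPDFReal_eq_one _ (toNNReal_sq_ne_zero (sd_pos_of_mem_sieve hθ _)), mul_one]
  exact hθ.1.2

lemma integrable_law_iff {θ : Param k} (hθ : θ ∈ sieve k m ε) {g : ℝ → ℝ} :
    Integrable g (law θ) ↔ Integrable fun x => density θ x * g x := by
  rw [law, integrable_withDensity_iff_integrable_smul'
    (continuous_density (sd_pos_of_mem_sieve hθ)).measurable.ennreal_ofReal
    (ae_of_all _ fun x => ENNReal.ofReal_lt_top)]
  simp_rw [ENNReal.toReal_ofReal (density_pos hθ _).le, smul_eq_mul]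

lemma integral_law {θ : Param k} (hθ : θ ∈ sieve k m ε) (g : ℝ → ℝ) :
    ∫ x, g x ∂(law θ) = ∫ x, density θ x * g x := by
  rw [law, integral_withDensity_eq_integral_toReal_smul
    (continuous_density (sd_pos_of_mem_sieve hθ)).measurable.ennreal_ofReal
    (ae_of_all _ fun x => ENNReal.ofReal_lt_top)]
  simp_rw [ENNReal.toReal_ofReal (density_pos hθ _).le, smul_eq_mul]

lemma integrable_one_add_sq_law {θ : Param k} (hθ : θ ∈ sieve k m ε) :
    Integrable (fun x => 1 + x ^ 2) (law θ) := by
  rw [integrable_law_iff hθ]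
  have h := sd_pos_of_mem_sieve hθ
  refine ((integrable_density_mul_pow h 0).add (integrable_density_mul_pow h 2)).congr
    (ae_of_all _ fun x => ?_)
  simp only [Pi.add_apply]
  ring

lemma integrable_log_density {θ₀ θ : Param k} (hθ₀ : θ₀ ∈ sieve k m ε) (hθ : θ ∈ sieve k m ε) :
    Integrable (fun x => Real.log (density θ x)) (law θ₀) := by
  obtain ⟨C, -, hC⟩ := exists_abs_log_density_le k m ε
  refine ((integrable_one_add_sq_law hθ₀).const_mul C).mono'
    (continuous_density (sd_pos_of_mem_sieve hθ)).measurable.log.aestronglyMeasurable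
    (ae_of_all _ fun x => hC θ hθ x)

/-- Gibbs' inequality with its equality case. -/
theorem density_eq_of_integral_log_density_le {θ₀ θ : Param k} (hθ₀ : θ₀ ∈ sieve k m ε)
    (hθ : θ ∈ sieve k m ε)
    (h : ∫ x, Real.log (density θ₀ x) ∂(law θ₀) ≤ ∫ x, Real.log (density θ x) ∂(law θ₀)) (x : ℝ) :
    density θ x = density θ₀ x := by
  -- The added `f_θ - f_θ₀` integrates to zero and makes the integrand pointwise nonnegative: it is
  -- `f_θ₀ (t - 1 - log t)` with `t = f_θ / f_θ₀`.
  let g : ℝ → ℝ := fun x => density θ₀ x * Real.log (density θ₀ x) -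
    density θ₀ x * Real.log (density θ x) - density θ₀ x + density θ x
  have hg : ∀ x, g x = density θ₀ x *
      (density θ x / density θ₀ x - 1 - Real.log (density θ x / density θ₀ x)) := by
    intro x
    have h0 := density_pos hθ₀ x
    rw [Real.log_div (density_pos hθ x).ne' h0.ne']
    simp only [g]
    field_simp
    ring
  have hg0 : ∀ x, 0 ≤ g x := by
    intro x
    rw [hg]
    have h0 := density_pos hθ₀ x
    have := Real.log_le_sub_one_of_pos (div_pos (density_pos hθ x) h0)
    exact mul_nonneg h0.le (by linarith)
  have hi0 := (integrable_law_iff hθ₀).1 (integrable_log_density hθ₀ hθ₀)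
  have hi := (integrable_law_iff hθ₀).1 (integrable_log_density hθ₀ hθ)
  have hd : ∀ {η : Param k}, η ∈ sieve k m ε → Integrable (density η) := fun hη => by
    simpa using integrable_density_mul_pow (sd_pos_of_mem_sieve hη) 0
  have hgi : Integrable g := ((hi0.sub hi).sub (hd hθ₀)).add (hd hθ)
  have hint : ∫ x, g x ≤ 0 := by
    have hsum : ∫ x, g x = ∫ x, (((fun x => density θ₀ x * Real.log (density θ₀ x)) -
        fun x => density θ₀ x * Real.log (density θ x)) - density θ₀ + density θ) x := rfl
    rw [hsum, integral_add' ((hi0.sub hi).sub (hd hθ₀)) (hd hθ),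
      integral_sub' (hi0.sub hi) (hd hθ₀), integral_sub' hi0 hi, integral_density hθ₀,
      integral_density hθ, ← integral_law hθ₀, ← integral_law hθ₀]
    linarith
  have hae : g =ᵐ[volume] 0 := (integral_eq_zero_iff_of_nonneg hg0 hgi).1
    (le_antisymm hint (integral_nonneg hg0))
  have hc0 := continuous_density (sd_pos_of_mem_sieve hθ₀)
  have hc := continuous_density (sd_pos_of_mem_sieve hθ)
  -- Continuity upgrades `g = 0` from almost everywhere to everywhere.
  have hgc : Continuous g :=
    (((hc0.mul (hc0.log fun x => (density_pos hθ₀ x).ne')).sub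
      (hc0.mul (hc.log fun x => (density_pos hθ x).ne'))).sub hc0).add hc
  have hgx : g x = 0 := congrFun (hgc.ae_eq_iff_eq volume continuous_zero |>.1 hae) x
  have h0 := density_pos hθ₀ x
  by_contra hne
  have hlt := Real.log_lt_sub_one_of_pos (div_pos (density_pos hθ x) h0)
    (fun h1 => hne ((div_eq_one_iff_eq h0.ne').1 h1))
  have := mul_pos h0 (by linarith : 0 <
    density θ x / density θ₀ x - 1 - Real.log (density θ x / density θ₀ x))
  rw [← hg, hgx] at this
  exact lt_irrefl _ this

end GaussianMixture

/-! ### Uniform law of large numbers and consistency -/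

namespace GaussianMixture

variable {k : ℕ} {m ε : ℝ}

instance compactSpace_sieve (k : ℕ) (m ε : ℝ) : CompactSpace (sieve k m ε) :=
  isCompact_iff_compactSpace.1 isCompact_sieve

/-- The map sending a datum `x` to the continuous function `θ ↦ log f_θ(x)` on the sieve. -/
noncomputable def logDensityMap (k : ℕ) (m ε : ℝ) : C(ℝ, C(sieve k m ε, ℝ)) :=
  ContinuousMap.curry
    ⟨fun p : ℝ × sieve k m ε => Real.log (density (p.2 : Param k) p.1),
      continuousOn_log_density.comp_continuous
        (f := fun p : ℝ × sieve k m ε => ((p.2 : Param k), p.1)) (by fun_prop)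
        fun p => ⟨p.2.2, Set.mem_univ _⟩⟩

@[simp]
lemma logDensityMap_apply (x : ℝ) (θ : sieve k m ε) :
    logDensityMap k m ε x θ = Real.log (density (θ : Param k) x) := rfl

lemma integrable_logDensityMap {θ₀ : Param k} (hθ₀ : θ₀ ∈ sieve k m ε) :
    Integrable (logDensityMap k m ε) (law θ₀) := by
  obtain ⟨C, hC0, hC⟩ := exists_abs_log_density_le k m ε
  refine ((integrable_one_add_sq_law hθ₀).const_mul C).mono'
    (logDensityMap k m ε).continuous.aestronglyMeasurable (ae_of_all _ fun x => ?_)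
  rw [ContinuousMap.norm_le _ (by positivity)]
  exact fun θ => hC θ θ.2 x

/-- Evaluation at `θ` is a continuous linear functional, so it commutes with the Bochner integral.
-/
lemma integral_logDensityMap_apply {θ₀ : Param k} (hθ₀ : θ₀ ∈ sieve k m ε)
    (θ : sieve k m ε) :
    (∫ x, logDensityMap k m ε x ∂(law θ₀)) θ =
      ∫ x, Real.log (density (θ : Param k) x) ∂(law θ₀) :=
  ((ContinuousMap.evalCLM ℝ θ).integral_comp_comm (integrable_logDensityMap hθ₀)).symm

/-- Uniform law of large numbers for the log-likelihood over the sieve. -/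
theorem uniform_law_of_large_numbers {θ₀ : Param k} (hθ₀ : θ₀ ∈ sieve k m ε)
    {Ω : Type*} [MeasurableSpace Ω] {P : Measure Ω}
    {X : ℕ → Ω → ℝ} (hindep : iIndepFun X P) (hlaw : ∀ i, HasLaw (X i) (law θ₀) P) :
    ∀ᵐ ω ∂P, Tendsto
      (fun n : ℕ => (n : ℝ)⁻¹ • ∑ i ∈ Finset.range n, logDensityMap k m ε (X i ω)) atTop
      (𝓝 (∫ x, logDensityMap k m ε x ∂(law θ₀))) := by
  borelize C(sieve k m ε, ℝ)
  have hF : Measurable (logDensityMap k m ε) := (logDensityMap k m ε).continuous.measurable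
  have hint : Integrable (fun ω => logDensityMap k m ε (X 0 ω)) P := by
    have h := integrable_logDensityMap hθ₀
    rw [← (hlaw 0).map_eq] at h
    exact h.comp_aemeasurable (hlaw 0).aemeasurable
  have h := strong_law_ae (μ := P) (fun i ω => logDensityMap k m ε (X i ω)) hint
    (fun i j hij => (hindep.indepFun hij).comp hF hF)
    (fun i => IdentDistrib.comp ⟨(hlaw i).aemeasurable, (hlaw 0).aemeasurable,
      (hlaw i).map_eq.trans (hlaw 0).map_eq.symm⟩ hF)
  have hE : ∫ ω, logDensityMap k m ε (X 0 ω) ∂P = ∫ x, logDensityMap k m ε x ∂(law θ₀) :=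
    (hlaw 0).integral_comp (logDensityMap k m ε).continuous.aestronglyMeasurable
  rwa [hE] at h

/-- If the averaged log-likelihood converges uniformly on the sieve, the maximizers eventually lie
in any open set on which the limit is not strictly below its value at `θ₀`. -/
lemma eventually_sieveMLE_subset {x : ℕ → ℝ} {L : C(sieve k m ε, ℝ)}
    (hL : Tendsto (fun n : ℕ => (n : ℝ)⁻¹ • ∑ i ∈ Finset.range n, logDensityMap k m ε (x i)) atTop
      (𝓝 L)) {U : Set (Param k)} (hU : IsOpen U) (θ₀ : sieve k m ε)
    (hLU : ∀ θ : sieve k m ε, L θ₀ ≤ L θ → (θ : Param k) ∈ U) :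
    ∀ᶠ n in atTop, sieveMLE k m ε x n ⊆ U := by
  have hG : ∀ (n : ℕ) (θ : sieve k m ε),
      ((n : ℝ)⁻¹ • ∑ i ∈ Finset.range n, logDensityMap k m ε (x i)) θ =
        (n : ℝ)⁻¹ * logLikelihood x n (θ : Param k) := by
    intro n θ
    simp [logLikelihood]
  have hcomp : IsCompact {θ : sieve k m ε | (θ : Param k) ∉ U} :=
    (hU.preimage continuous_subtype_val).isClosed_compl.isCompact
  rcases Set.eq_empty_or_nonempty {θ : sieve k m ε | (θ : Param k) ∉ U} with he | hne
  · refine Eventually.of_forall fun n θ hθ => ?_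
    by_contra hθU
    have : (⟨θ, hθ.1⟩ : sieve k m ε) ∈ {θ : sieve k m ε | (θ : Param k) ∉ U} := hθU
    rw [he] at this
    exact this
  · obtain ⟨η, hη, hmax⟩ := hcomp.exists_isMaxOn hne L.continuous.continuousOn
    have hlt : L η < L θ₀ := lt_of_not_ge fun h => hη (hLU η h)
    -- Half the gap: the errors at `θ` and at `θ₀` together cannot close it.
    filter_upwards [Metric.tendsto_nhds.1 hL ((L θ₀ - L η) / 2) (by linarith)] with n hn θ hθ
    by_contra hθU
    have h1 : L ⟨θ, hθ.1⟩ ≤ L η := hmax (a := (⟨θ, hθ.1⟩ : sieve k m ε)) hθU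
    have h2 := (ContinuousMap.dist_apply_le_dist (⟨θ, hθ.1⟩ : sieve k m ε)).trans_lt hn
    have h3 := (ContinuousMap.dist_apply_le_dist θ₀).trans_lt hn
    rw [Real.dist_eq, hG, abs_lt] at h2 h3
    have h4 : (n : ℝ)⁻¹ * logLikelihood x n θ₀ ≤ (n : ℝ)⁻¹ * logLikelihood x n θ :=
      mul_le_mul_of_nonneg_left (hθ.2 θ₀.2) (by positivity)
    linarith [h2.2, h3.1]

/-- Almost surely, all sieve maximum likelihood estimators eventually lie in any given open set
containing the permutation orbit of the true parameter. -/
theorem ae_eventually_sieveMLE_subset {θ₀ : Param k} (hθ₀ : θ₀ ∈ sieve k m ε)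
    (hpos : ∀ j, 0 < θ₀.weight j)
    (hdistinct : Function.Injective fun j => (θ₀.mean j, θ₀.sd j))
    {Ω : Type*} [MeasurableSpace Ω] {P : Measure Ω}
    {X : ℕ → Ω → ℝ} (hindep : iIndepFun X P) (hlaw : ∀ i, HasLaw (X i) (law θ₀) P) :
    ∀ᵐ ω ∂P, ∀ U : Set (Param k), IsOpen U → permOrbit θ₀ ⊆ U →
      ∀ᶠ n in atTop, sieveMLE k m ε (fun i => X i ω) n ⊆ U := by
  -- The only exceptional event is that of the law of large numbers, so it does not depend on `U`.
  filter_upwards [uniform_law_of_large_numbers hθ₀ hindep hlaw] with ω hω U hU hsub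
  refine eventually_sieveMLE_subset hω hU ⟨θ₀, hθ₀⟩ fun θ hθ => hsub ?_
  rw [integral_logDensityMap_apply hθ₀, integral_logDensityMap_apply hθ₀] at hθ
  exact mem_permOrbit_of_density_eq (sd_pos_of_mem_sieve θ.2) (sd_pos_of_mem_sieve hθ₀) hpos
    hdistinct (density_eq_of_integral_log_density_le hθ₀ θ.2 hθ)

/-! ### From neighbourhoods of the orbit to Hausdorff convergence -/

lemma hausdorffDistOf_le {α : Type*} {d : α → α → ℝ} {A B : Set α} {δ : ℝ}
    (hA : ∀ a ∈ A, ∃ b ∈ B, d a b ≤ δ) (hB : ∀ b ∈ B, ∃ a ∈ A, d a b ≤ δ) :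
    hausdorffDistOf d A B ≤ ENNReal.ofReal δ := by
  refine max_le (iSup₂_le fun a ha => ?_) (iSup₂_le fun b hb => ?_)
  · obtain ⟨b, hb, h⟩ := hA a ha
    exact (iInf₂_le b hb).trans (ENNReal.ofReal_le_ofReal h)
  · obtain ⟨a, ha, h⟩ := hB b hb
    exact (iInf₂_le a ha).trans (ENNReal.ofReal_le_ofReal h)

lemma tendsto_hausdorffDistOf {α : Type*} {d : α → α → ℝ} {A : ℕ → Set α} {B : Set α}
    (h : ∀ δ > 0, ∀ᶠ n in atTop,
      (∀ a ∈ A n, ∃ b ∈ B, d a b ≤ δ) ∧ ∀ b ∈ B, ∃ a ∈ A n, d a b ≤ δ) :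
    Tendsto (fun n => hausdorffDistOf d (A n) B) atTop (𝓝 0) := by
  rw [ENNReal.tendsto_nhds_zero]
  intro r hr
  obtain ⟨δ, -, hδ, hδr⟩ := ENNReal.lt_iff_exists_real_btwn.1 hr
  filter_upwards [h δ (ENNReal.ofReal_pos.1 hδ)] with n hn
  exact (hausdorffDistOf_le hn.1 hn.2).trans hδr.le

/-- The distance minimized over all permutations in `matchingDist`. -/
noncomputable def labelledDist (θ θ' : Param k) : ℝ :=
  √(∑ j, (θ.mean j - θ'.mean j) ^ 2) + √(∑ j, (θ.sd j - θ'.sd j) ^ 2)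
    + ∑ j, |θ.weight j - θ'.weight j|

lemma matchingDist_le (θ θ' : Param k) (τ : Equiv.Perm (Fin k)) :
    matchingDist θ θ' ≤ labelledDist (θ.permute τ) θ' :=
  ciInf_le (Set.finite_range _).bddBelow τ

lemma labelledDist_permute (θ θ' : Param k) (τ : Equiv.Perm (Fin k)) :
    labelledDist (θ.permute τ) (θ'.permute τ) = labelledDist θ θ' := by
  unfold labelledDist
  congr 1
  · congr 2
    · exact Equiv.sum_comp τ fun j => (θ.mean j - θ'.mean j) ^ 2
    · exact Equiv.sum_comp τ fun j => (θ.sd j - θ'.sd j) ^ 2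
  · exact Equiv.sum_comp τ fun j => |θ.weight j - θ'.weight j|

lemma euclideanDist_permute (θ θ' : Param k) (τ : Equiv.Perm (Fin k)) :
    euclideanDist (θ.permute τ) (θ'.permute τ) = euclideanDist θ θ' := by
  unfold euclideanDist
  congr 1
  exact Equiv.sum_comp τ fun j => (θ.weight j - θ'.weight j) ^ 2 + (θ.mean j - θ'.mean j) ^ 2
    + (θ.sd j - θ'.sd j) ^ 2

/-- Relabelling by `τ⁻¹ * τ'` moves the orbit point close to an estimator onto any prescribed orbit
point. -/
lemma permute_permute_inv_mul (θ : Param k) (τ τ' : Equiv.Perm (Fin k)) :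
    (θ.permute τ).permute (τ⁻¹ * τ') = θ.permute τ' := by
  simp [Param.permute, Param.weight, Param.mean, Param.sd, Function.comp_def]

/-- A neighbourhood of the permutation orbit, for a continuous distance function. -/
lemma eventually_exists_lt {θ₀ : Param k} {A : ℕ → Set (Param k)}
    (hA : ∀ U : Set (Param k), IsOpen U → permOrbit θ₀ ⊆ U → ∀ᶠ n in atTop, A n ⊆ U)
    {d : Param k → Param k → ℝ} (hd : ∀ b, Continuous fun a => d a b) (hd0 : ∀ a, d a a = 0)
    {δ : ℝ} (hδ : 0 < δ) :
    ∀ᶠ n in atTop, ∀ a ∈ A n, ∃ τ, d a (θ₀.permute τ) < δ := by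
  have hU : IsOpen {a : Param k | ∃ τ, d a (θ₀.permute τ) < δ} := by
    simp only [Set.ofPred_exists]
    exact isOpen_iUnion fun τ => isOpen_lt (hd _) continuous_const
  refine hA _ hU ?_
  rintro _ ⟨τ, rfl⟩
  exact ⟨τ, by simpa only [hd0] using hδ⟩

/-- The matching distance ignores labels: an estimator close to one orbit point is close to all, so
a single estimator covers the orbit. -/
theorem tendsto_hausdorffDistOf_matchingDist {θ₀ : Param k} {A : ℕ → Set (Param k)}
    (hA : ∀ U : Set (Param k), IsOpen U → permOrbit θ₀ ⊆ U → ∀ᶠ n in atTop, A n ⊆ U)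
    (hne : ∀ n, (A n).Nonempty) :
    Tendsto (fun n => hausdorffDistOf matchingDist (A n) (permOrbit θ₀)) atTop (𝓝 0) := by
  refine tendsto_hausdorffDistOf fun δ hδ => ?_
  filter_upwards [eventually_exists_lt hA (d := labelledDist)
    (fun b => by unfold labelledDist; fun_prop) (fun a => by simp [labelledDist]) hδ] with n hn
  have key : ∀ a ∈ A n, ∀ b ∈ permOrbit θ₀, matchingDist a b ≤ δ := by
    rintro a ha _ ⟨τ', rfl⟩
    obtain ⟨τ, hτ⟩ := hn a ha
    refine (matchingDist_le a _ (τ⁻¹ * τ')).trans ?_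
    beta_reduce
    rw [← permute_permute_inv_mul θ₀ τ τ', labelledDist_permute]
    exact hτ.le
  obtain ⟨a₀, ha₀⟩ := hne n
  exact ⟨fun a ha => ⟨_, ⟨1, rfl⟩, key a ha _ ⟨1, rfl⟩⟩, fun b hb => ⟨a₀, ha₀, key a₀ ha₀ b hb⟩⟩

/-- Here `A n` might approach only one labelling; invariance supplies an estimator near every orbit
point. -/
theorem tendsto_hausdorffDistOf_euclideanDist {θ₀ : Param k} {A : ℕ → Set (Param k)}
    (hA : ∀ U : Set (Param k), IsOpen U → permOrbit θ₀ ⊆ U → ∀ᶠ n in atTop, A n ⊆ U)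
    (hne : ∀ n, (A n).Nonempty)
    (hperm : ∀ n, ∀ θ ∈ A n, ∀ τ : Equiv.Perm (Fin k), θ.permute τ ∈ A n) :
    Tendsto (fun n => hausdorffDistOf euclideanDist (A n) (permOrbit θ₀)) atTop (𝓝 0) := by
  refine tendsto_hausdorffDistOf fun δ hδ => ?_
  filter_upwards [eventually_exists_lt hA (d := euclideanDist)
    (fun b => by unfold euclideanDist; fun_prop) (fun a => by simp [euclideanDist]) hδ] with n hn
  constructor
  · intro a ha
    obtain ⟨τ, hτ⟩ := hn a ha
    exact ⟨_, ⟨τ, rfl⟩, hτ.le⟩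
  · rintro _ ⟨τ', rfl⟩
    obtain ⟨a, ha⟩ := hne n
    obtain ⟨τ, hτ⟩ := hn a ha
    refine ⟨_, hperm n a ha (τ⁻¹ * τ'), ?_⟩
    beta_reduce
    rw [← permute_permute_inv_mul θ₀ τ τ', euclideanDist_permute]
    exact hτ.le

end GaussianMixture

theorem mainTheorem8 (k : ℕ) (hk : 2 ≤ k)
    (θ₀ : GaussianMixture.Param k) (hθ₀ : θ₀ ∈ GaussianMixture.parameterSpace k)
    (hpos : ∀ j, 0 < θ₀.weight j)
    (hdistinct : Function.Injective fun j => (θ₀.mean j, θ₀.sd j))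
    (m ε : ℝ) (hm : 1 ≤ m) (hε : 0 < ε) (hεk : ε ≤ 1 / (k : ℝ))
    (hsieve : θ₀ ∈ GaussianMixture.sieve k m ε)
    {Ω : Type*} [MeasurableSpace Ω] (P : Measure Ω) [IsProbabilityMeasure P]
    (X : ℕ → Ω → ℝ) (hindep : iIndepFun X P)
    (hlaw : ∀ i, HasLaw (X i) (GaussianMixture.law θ₀) P) :
    (∀ (n : ℕ) (ω : Ω), (GaussianMixture.sieveMLE k m ε (fun i => X i ω) n).Nonempty) ∧
    ∀ᵐ ω ∂P, ∀ A : ℕ → Set (GaussianMixture.Param k),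
      (∀ n, (A n).Nonempty ∧ A n ⊆ GaussianMixture.sieveMLE k m ε (fun i => X i ω) n) →
        Tendsto (fun n => GaussianMixture.hausdorffDistOf GaussianMixture.matchingDist
          (A n) (GaussianMixture.permOrbit θ₀)) atTop (𝓝 0) ∧
        ((∀ n, ∀ θ ∈ A n, ∀ τ : Equiv.Perm (Fin k), θ.permute τ ∈ A n) →
          Tendsto (fun n => GaussianMixture.hausdorffDistOf GaussianMixture.euclideanDist
            (A n) (GaussianMixture.permOrbit θ₀)) atTop (𝓝 0)) := by
  refine ⟨fun n ω => GaussianMixture.sieveMLE_nonempty ⟨θ₀, hsieve⟩ _ n, ?_⟩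
  filter_upwards [GaussianMixture.ae_eventually_sieveMLE_subset hsieve hpos hdistinct hindep hlaw]
    with ω hω A hA
  have hAU : ∀ U : Set (GaussianMixture.Param k), IsOpen U → GaussianMixture.permOrbit θ₀ ⊆ U →
      ∀ᶠ n in atTop, A n ⊆ U := fun U hU hsub =>
    (hω U hU hsub).mono fun n hn => (hA n).2.trans hn
  exact ⟨GaussianMixture.tendsto_hausdorffDistOf_matchingDist hAU fun n => (hA n).1,
    fun hperm => GaussianMixture.tendsto_hausdorffDistOf_euclideanDist hAU (fun n => (hA n).1) hperm⟩
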